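/- Let $m,n,p,k\ge 1$ be integers, let $A_1,\dots,A_p\in\mathbb R^{m\times n}$, and let $\mathcal A(M)=(\langle A_1,M\rangle,\dots,\langle A_p,M\rangle)\in\mathbb R^p$ with $\langle A,M\rangle=\mathrm{tr}(A^{\mathsf T}M)$. The map $\mathcal A$ satisfies $2k$-RIP with constant $\delta_{2k}\in(0,1)$ if $(1-\delta_{2k})\|M\|_F^2\le\|\mathcal A(M)\|_2^2\le(1+\delta_{2k})\|M\|_F^2$ for every $M\in\mathbb R^{m\times n}$ of rank at most $2k$. For $\omega\in(0,1)$ put $\rho_\omega(t)=t^2\,|\omega-\mathbf 1(t<0)|$ and, for $b\in\mathbb R^p$, $X\in\mathbb R^{m\times k}$, $Y\in\mathbb R^{n\times k}$, $F(X,Y)=\sum_{i=1}^p\rho_\omega\bigl(b_i-\langle A_i,XY^{\mathsf T}\rangle\bigr)$. **Algorithm 1** (input $b$ and $A_1,\dots,A_p$; number of iterations $T\ge 1$). Let $(\bar X^{(0)},D^{(0)},\bar Y^{(0)})$ be a top-$k$ truncated singular value decomposition of $\sum_{i=1}^p b_iA_i$. For $t=0,\dots,T-1$: let $Y^{(t+0.5)}\in\arg\min_Y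 F(\bar X^{(t)},Y)$; let $\bar Y^{(t+1)}$ be the orthonormal factor of a QR decomposition of $Y^{(t+0.5)}$; let $X^{(t+0.5)}\in\arg\min_X F(X,\bar Y^{(t+1)})$; let $\bar X^{(t+1)}$ be the orthonormal factor of a QR decomposition of $X^{(t+0.5)}$. Output $M^{(T)}=X^{(T-0.5)}\bar Y^{(T)\mathsf T}$. **Theorem 2 (Optimality of Algorithm 1).** For each $\omega\in(0,1)$ there is a constant $c(\omega)>0$, and for all $0<\Sigma_{\min}\le\Sigma_{\max}$ there are constants $C_3,C_4>0$ depending only on $\Sigma_{\min},\Sigma_{\max}$, such that the following holds for all $\omega\in(0,1)$ and all $m,n,p,k$ and $A_1,\dots,A_p$. Let $M^*\in\mathbb R^{m\times n}$ have rank $k$ and let its $k$ nonzero singular values lie in $[\Sigma_{\min},\Sigma_{\max}]$. First let $\omega\le 1/2$, and let $\mathcal A$ satisfy $2k$-RIP with $$\delta_{2k}\le\frac{C_3}{k}\cdot\frac{\omega^2}{(1-\omega)^2}.$$ Then, for every $\varepsilon>0$, Algorithm 1 run on the noiseless observations $b=\mathcal A(M^*)$ satisfies $\|M^{(T)}-M^*\|_F\le\varepsilon$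 for all integers $T\ge 1$ with $$T\ \ge\ c(\omega)\Bigl(\log\frac{C_4}{\varepsilon}+\log\frac{\omega}{1-\omega}\Bigr),$$ whichever minimizers and decompositions it selects when these are not unique. If $\omega>1/2$, the same holds with $\omega$ replaced by $1-\omega$ in the two displayed conditions (the loss in Algorithm 1 remains $\rho_\omega$, and the constant remains $c(\omega)$). -/

import Mathlib

open scoped Matrix Matrix.Norms.Frobenius

namespace EMF

/-- The asymmetric least squares loss `ρ_ω(t) = t² |ω - 1(t < 0)|`. -/
noncomputable def asymSq (ω t : ℝ) : ℝ :=
  t ^ 2 * |ω - (if t < 0 then 1 else 0)|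

/-- The linear map `M ↦ (⟨A₁, M⟩, …, ⟨A_p, M⟩)`, where `⟨A, M⟩ = tr (Aᵀ M)`. -/
noncomputable def measure {m n p : ℕ} (A : Fin p → Matrix (Fin m) (Fin n) ℝ)
    (M : Matrix (Fin m) (Fin n) ℝ) : EuclideanSpace ℝ (Fin p) :=
  WithLp.toLp 2 fun i => ((A i)ᵀ * M).trace

/-- The restricted isometry property of order `r` with constant `δ`
(matrices carry the Frobenius norm, `ℝ^p` the Euclidean norm). -/
def RIP {m n p : ℕ} (r : ℕ) (δ : ℝ) (A : Fin p → Matrix (Fin m) (Fin n) ℝ) : Prop :=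
  ∀ M : Matrix (Fin m) (Fin n) ℝ, M.rank ≤ r →
    (1 - δ) * ‖M‖ ^ 2 ≤ ‖measure A M‖ ^ 2 ∧ ‖measure A M‖ ^ 2 ≤ (1 + δ) * ‖M‖ ^ 2

/-- The objective `F(X, Y) = ∑ i, ρ_ω (b_i - ⟨A_i, X Yᵀ⟩)`. -/
noncomputable def objective {m n p k : ℕ} (ω : ℝ) (A : Fin p → Matrix (Fin m) (Fin n) ℝ)
    (b : EuclideanSpace ℝ (Fin p)) (X : Matrix (Fin m) (Fin k) ℝ)
    (Y : Matrix (Fin n) (Fin k) ℝ) : ℝ :=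
  ∑ i, asymSq ω (b i - measure A (X * Yᵀ) i)

/-- `(U, s, V)` is a (full) singular value decomposition of `B`: `U`, `V` are orthogonal, the
singular values are nonnegative and listed in non-increasing order (the entries of `s` beyond
`min m n` play no role), and `B = U Σ Vᵀ`. -/
def IsSVD {m n : ℕ} (B : Matrix (Fin m) (Fin n) ℝ) (U : Matrix (Fin m) (Fin m) ℝ)
    (s : ℕ → ℝ) (V : Matrix (Fin n) (Fin n) ℝ) : Prop :=
  U ∈ Matrix.orthogonalGroup (Fin m) ℝ ∧ V ∈ Matrix.orthogonalGroup (Fin n) ℝ ∧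
    Antitone s ∧ (∀ i, 0 ≤ s i) ∧
    B = U * (Matrix.of fun (i : Fin m) (j : Fin n) => if (i : ℕ) = j then s i else 0) * Vᵀ

/-- `(X, D, Y)` is a top-`k` truncated singular value decomposition of `B`: the first `k` left
singular vectors, singular values and right singular vectors of some singular value
decomposition of `B`. -/
def IsTopSVD {m n k : ℕ} (B : Matrix (Fin m) (Fin n) ℝ) (X : Matrix (Fin m) (Fin k) ℝ)
    (D : Matrix (Fin k) (Fin k) ℝ) (Y : Matrix (Fin n) (Fin k) ℝ) : Prop :=
  ∃ (U : Matrix (Fin m) (Fin m) ℝ) (s : ℕ → ℝ) (V : Matrix (Fin n) (Fin n) ℝ)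
    (hm : k ≤ m) (hn : k ≤ n), IsSVD B U s V ∧
      X = U.submatrix id (Fin.castLE hm) ∧
      D = Matrix.diagonal (fun i : Fin k => s i) ∧
      Y = V.submatrix id (Fin.castLE hn)

/-- `Z = Q R` is a QR decomposition: `Q` has orthonormal columns, `R` is upper triangular. -/
def IsQR {n k : ℕ} (Z Q : Matrix (Fin n) (Fin k) ℝ) (R : Matrix (Fin k) (Fin k) ℝ) : Prop :=
  Qᵀ * Q = 1 ∧ R.BlockTriangular id ∧ Z = Q * R

/-- The four sequences are the iterates of a run, with `T` iterations, of alternating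
minimization with input `b` and `A`. Here `Yhalf t` stands for `Y^(t + 0.5)` and `Xhalf t` for
`X^(t + 0.5)`. Wherever the decompositions or minimizers are not unique, every choice is
admitted. -/
structure IsRun {m n p k : ℕ} (ω : ℝ) (A : Fin p → Matrix (Fin m) (Fin n) ℝ)
    (b : EuclideanSpace ℝ (Fin p)) (T : ℕ)
    (Xbar Xhalf : ℕ → Matrix (Fin m) (Fin k) ℝ)
    (Ybar Yhalf : ℕ → Matrix (Fin n) (Fin k) ℝ) : Prop where
  /-- `(X̄⁽⁰⁾, D⁽⁰⁾, Ȳ⁽⁰⁾) = SVD_k (∑ i, b_i A_i)` -/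
  init : ∃ D : Matrix (Fin k) (Fin k) ℝ, IsTopSVD (∑ i, b i • A i) (Xbar 0) D (Ybar 0)
  /-- `Y^(t + 0.5)` minimizes `F(X̄⁽ᵗ⁾, ·)` -/
  y_step : ∀ t < T, ∀ Y : Matrix (Fin n) (Fin k) ℝ,
    objective ω A b (Xbar t) (Yhalf t) ≤ objective ω A b (Xbar t) Y
  /-- `Ȳ^(t + 1) = QR(Y^(t + 0.5))` -/
  y_qr : ∀ t < T, ∃ R : Matrix (Fin k) (Fin k) ℝ, IsQR (Yhalf t) (Ybar (t + 1)) R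
  /-- `X^(t + 0.5)` minimizes `F(·, Ȳ^(t + 1))` -/
  x_step : ∀ t < T, ∀ X : Matrix (Fin m) (Fin k) ℝ,
    objective ω A b (Xhalf t) (Ybar (t + 1)) ≤ objective ω A b X (Ybar (t + 1))
  /-- `X̄^(t + 1) = QR(X^(t + 0.5))` -/
  x_qr : ∀ t < T, ∃ R : Matrix (Fin k) (Fin k) ℝ, IsQR (Xhalf t) (Xbar (t + 1)) R

end EMF

/-! Write `a = min ω (1 - ω)`, `b = max ω (1 - ω)`, `r = a / b`. The data are noiseless, so the
objective is the loss of `measure A N` with residual `N = M - X Yᵀ`. The weights lie in `[a, b]` and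
RIP applies to `N`, of rank at most `2k`, so the loss is comparable to `‖N‖ ^ 2`.

The heart is `exists_objective_le`. When `Y = Q R` is optimal for `X`, the slope of the loss
vanishes along every `X Z`. The loss is homogeneous of degree two, so its slope along `N` is the
loss `L` itself; hence the slope along `G = (1 - X Xᵀ) N = (1 - X Xᵀ) M` is also `L`. Split `G = H +
S` with `H = G Q Qᵀ`. The part `H` can be reached by changing the left factor while keeping `Q`; the
part `S = (1 - X Xᵀ) M (1 - Q Qᵀ)` is of second order, since `s ‖S‖ ≤ ‖N‖ ^ 2` when the nonzero
singular values of `M` are at least `s`. For small `N` the slope along `H` is thus at least `L / 2`,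
and a step along `H` multiplies the loss by at most `1 - r / 12`.

Spectral initialization gives `‖M - X Xᵀ M‖ ≤ 2 δ ‖M‖`, which puts the first residual in the basin
where this applies. The loss never increases afterwards, so the iterates stay there and converge
linearly. -/

namespace EMF

/-! ### Frobenius geometry of orthogonal projections. -/

section Frobenius

variable {m n k : ℕ}

theorem trace_transpose_mul (A B : Matrix (Fin m) (Fin n) ℝ) :
    (Aᵀ * B).trace = ∑ i, ∑ j, A i j * B i j := by
  simp only [Matrix.trace, Matrix.diag_apply, Matrix.mul_apply, Matrix.transpose_apply]
  exact Finset.sum_comm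

theorem norm_sq_eq_sum (A : Matrix (Fin m) (Fin n) ℝ) : ‖A‖ ^ 2 = ∑ i, ∑ j, A i j ^ 2 := by
  rw [Matrix.frobenius_norm_def, ← Real.sqrt_eq_rpow, Real.sq_sqrt]
  · simp
  · positivity

theorem norm_sq_eq_trace (A : Matrix (Fin m) (Fin n) ℝ) : ‖A‖ ^ 2 = (Aᵀ * A).trace := by
  rw [trace_transpose_mul, norm_sq_eq_sum]
  simp [sq]

theorem trace_transpose_mul_comm (A B : Matrix (Fin m) (Fin n) ℝ) :
    (Aᵀ * B).trace = (Bᵀ * A).trace := by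
  simp only [trace_transpose_mul, mul_comm]

theorem norm_add_smul_sq (A B : Matrix (Fin m) (Fin n) ℝ) (s : ℝ) :
    ‖A + s • B‖ ^ 2 = ‖A‖ ^ 2 + 2 * s * (Aᵀ * B).trace + s ^ 2 * ‖B‖ ^ 2 := by
  simp only [norm_sq_eq_trace, Matrix.transpose_add, Matrix.transpose_smul, Matrix.add_mul,
    Matrix.mul_add, Matrix.smul_mul, Matrix.mul_smul, Matrix.trace_add, Matrix.trace_smul,
    smul_eq_mul, trace_transpose_mul_comm B A]
  ring

theorem norm_sub_sq_eq (A B : Matrix (Fin m) (Fin n) ℝ) :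
    ‖A - B‖ ^ 2 = ‖A‖ ^ 2 - 2 * (Aᵀ * B).trace + ‖B‖ ^ 2 := by
  have := norm_add_smul_sq A B (-1)
  rw [neg_one_smul, ← sub_eq_add_neg] at this
  rw [this]; ring

variable {X : Matrix (Fin m) (Fin k) ℝ}

theorem norm_orthonormal_mul (hX : Xᵀ * X = 1) (Z : Matrix (Fin k) (Fin n) ℝ) : ‖X * Z‖ = ‖Z‖ := by
  rw [← sq_eq_sq₀ (norm_nonneg _) (norm_nonneg _), norm_sq_eq_trace, norm_sq_eq_trace,
    Matrix.transpose_mul, Matrix.mul_assoc, ← Matrix.mul_assoc Xᵀ, hX, Matrix.one_mul]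

/-- Pythagoras for the orthogonal projection `X Xᵀ`. -/
theorem norm_sub_proj_sq (hX : Xᵀ * X = 1) (M : Matrix (Fin m) (Fin n) ℝ) :
    ‖M - X * (Xᵀ * M)‖ ^ 2 = ‖M‖ ^ 2 - ‖Xᵀ * M‖ ^ 2 := by
  have h : (Mᵀ * (X * (Xᵀ * M))).trace = ‖Xᵀ * M‖ ^ 2 := by
    rw [norm_sq_eq_trace, Matrix.transpose_mul, Matrix.transpose_transpose, Matrix.mul_assoc]
  rw [norm_sub_sq_eq, norm_orthonormal_mul hX, h]
  ring

theorem norm_sub_proj_le (hX : Xᵀ * X = 1) (M : Matrix (Fin m) (Fin n) ℝ) :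
    ‖M - X * (Xᵀ * M)‖ ≤ ‖M‖ := by
  rw [← sq_le_sq₀ (norm_nonneg _) (norm_nonneg _), norm_sub_proj_sq hX]
  linarith [sq_nonneg ‖Xᵀ * M‖]

theorem norm_transpose_orthonormal_mul_le (hX : Xᵀ * X = 1) (M : Matrix (Fin m) (Fin n) ℝ) :
    ‖Xᵀ * M‖ ≤ ‖M‖ := by
  rw [← sq_le_sq₀ (norm_nonneg _) (norm_nonneg _)]
  linarith [norm_sub_proj_sq hX M, sq_nonneg ‖M - X * (Xᵀ * M)‖]

theorem norm_mul_orthonormal_le (hX : Xᵀ * X = 1) (M : Matrix (Fin n) (Fin m) ℝ) :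
    ‖M * X‖ ≤ ‖M‖ := by
  rw [← Matrix.frobenius_norm_transpose, Matrix.transpose_mul, ← Matrix.frobenius_norm_transpose M]
  exact norm_transpose_orthonormal_mul_le hX _

theorem norm_mul_orthonormal_transpose (hX : Xᵀ * X = 1) (M : Matrix (Fin n) (Fin k) ℝ) :
    ‖M * Xᵀ‖ = ‖M‖ := by
  rw [← Matrix.frobenius_norm_transpose, Matrix.transpose_mul, Matrix.transpose_transpose,
    norm_orthonormal_mul hX, Matrix.frobenius_norm_transpose]

theorem norm_sub_mul_proj_le (hX : Xᵀ * X = 1) (M : Matrix (Fin n) (Fin m) ℝ) :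
    ‖M - M * X * Xᵀ‖ ≤ ‖M‖ := by
  rw [← Matrix.frobenius_norm_transpose, Matrix.transpose_sub, Matrix.transpose_mul,
    Matrix.transpose_mul, Matrix.transpose_transpose, ← Matrix.frobenius_norm_transpose M]
  exact norm_sub_proj_le hX _

theorem sum_castLE_of_zero {β : Type*} [AddCommMonoid β] (h : k ≤ n) (f : Fin n → β)
    (hf : ∀ i : Fin n, k ≤ i → f i = 0) : ∑ i, f i = ∑ i : Fin k, f (Fin.castLE h i) := by
  symm
  refine Fintype.sum_of_injective (Fin.castLE h) (Fin.castLE_injective h) _ _ ?_ fun _ => rfl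
  intro i hi
  apply hf
  by_contra hlt
  exact hi ⟨⟨i, not_le.mp hlt⟩, rfl⟩

end Frobenius

/-! ### Thin singular value decomposition and its norm bounds. -/

section ThinSVD

variable {m n k : ℕ} {M : Matrix (Fin m) (Fin n) ℝ}

/-- The right factor of the thin singular value decomposition of a matrix of rank `k`. -/
theorem exists_right_singular (hk : M.rank = k) :
    ∃ V : Matrix (Fin n) (Fin k) ℝ, Vᵀ * V = 1 ∧ M * V * Vᵀ = M ∧
      (M * V)ᵀ * (M * V) =
        Matrix.diagonal fun i : Fin k => (Matrix.toEuclideanLin M).singularValues i ^ 2 := by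
  have hkn : k ≤ n := hk ▸ (M.rank_le_width)
  set T := Matrix.toEuclideanLin M with hT
  have hn : Module.finrank ℝ (EuclideanSpace ℝ (Fin n)) = n := by simp
  set e := T.isSymmetric_adjoint_comp_self.eigenvectorBasis hn with he
  have hrank : Module.finrank ℝ T.range = k := by
    rw [← hk, Matrix.rank_eq_finrank_range_toLin M (EuclideanSpace.basisFun _ ℝ).toBasis
      (EuclideanSpace.basisFun _ ℝ).toBasis, hT, Matrix.toEuclideanLin_eq_toLin_orthonormal]
  have hin : ∀ i j, inner ℝ (T (e i)) (T (e j)) = if i = j then T.singularValues j ^ 2 else 0 := by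
    intro i j
    rw [← LinearMap.adjoint_inner_right]
    have := T.isSymmetric_adjoint_comp_self.apply_eigenvectorBasis hn j
    rw [LinearMap.comp_apply] at this
    rw [← he] at this
    rw [this, ← T.sq_singularValues_fin hn, inner_smul_right, e.inner_eq_ite]
    simp
  set W : Matrix (Fin n) (Fin n) ℝ := Matrix.of fun j i => e i j with hW
  have hWW : Wᵀ * W = 1 := by
    ext i j
    have := e.inner_eq_ite i j
    rw [PiLp.inner_apply] at this
    rw [Matrix.mul_apply, Matrix.one_apply, ← this]
    exact Finset.sum_congr rfl fun x _ => mul_comm _ _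
  have hWW' : W * Wᵀ = 1 := mul_eq_one_comm.mp hWW
  have hMW : ∀ a i, (M * W) a i = T (e i) a := by
    intro a i
    simp [hT, Matrix.mul_apply, hW, Matrix.toLpLin_apply, Matrix.mulVec, dotProduct]
  -- The singular values are sorted, so those of index at least the rank vanish, and the first `k`
  -- basis vectors suffice.
  have hz : ∀ i : Fin n, k ≤ i → T (e i) = 0 := by
    intro i hi
    rw [← inner_self_eq_zero (𝕜 := ℝ), hin, if_pos rfl,
      T.singularValues_eq_zero_iff_le_finrank_range.mpr (hrank ▸ hi)]
    simp
  have hMV : ∀ a i, (M * W.submatrix id (Fin.castLE hkn)) a i = T (e (Fin.castLE hkn i)) a :=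
    fun a i => hMW a _
  refine ⟨W.submatrix id (Fin.castLE hkn), ?_, ?_, ?_⟩
  · ext i j
    have := congrFun₂ hWW (Fin.castLE hkn i) (Fin.castLE hkn j)
    simpa [Matrix.mul_apply, Matrix.one_apply] using this
  · conv_rhs => rw [← Matrix.mul_one M, ← hWW', ← Matrix.mul_assoc]
    ext a b
    rw [Matrix.mul_apply, Matrix.mul_apply, sum_castLE_of_zero hkn]
    · rfl
    · intro i hi
      rw [hMW, hz i hi]
      simp
  · ext i j
    have := hin (Fin.castLE hkn i) (Fin.castLE hkn j)
    rw [PiLp.inner_apply] at this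
    rw [Matrix.mul_apply, Matrix.diagonal_apply]
    simp only [Matrix.transpose_apply, hMV]
    refine Eq.trans (Finset.sum_congr rfl fun x _ => mul_comm _ _) (this.trans ?_)
    by_cases h : i = j
    · rw [if_pos h, if_pos (congrArg _ h), h, Fin.val_castLE]
    · rw [if_neg h, if_neg fun h' => h (Fin.castLE_injective hkn h')]

/-- A product through a matrix of rank `k` whose nonzero singular values are at least `s`. -/
theorem mul_norm_mul_mul_le {l q : ℕ} {s : ℝ} (hs : 0 ≤ s) (hk : M.rank = k)
    (hM : ∀ i < k, s ≤ (Matrix.toEuclideanLin M).singularValues i)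
    (A : Matrix (Fin l) (Fin m) ℝ) (B : Matrix (Fin n) (Fin q) ℝ) :
    s * ‖A * M * B‖ ≤ ‖A * M‖ * ‖M * B‖ := by
  obtain ⟨V, hV, hMV, hD⟩ := exists_right_singular hk
  have h1 : A * M * B = A * M * V * (Vᵀ * B) := by
    conv_lhs => rw [← hMV]
    simp only [Matrix.mul_assoc]
  -- The Gram matrix of `M * V` is diagonal with entries at least `s ^ 2`, so `M * V` stretches
  -- every vector by at least `s`.
  have h2 : s * ‖Vᵀ * B‖ ≤ ‖M * B‖ := by
    rw [← sq_le_sq₀ (by positivity) (norm_nonneg _), mul_pow]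
    conv_rhs => rw [← hMV, Matrix.mul_assoc, norm_sq_eq_trace, Matrix.transpose_mul,
      Matrix.mul_assoc, ← Matrix.mul_assoc (M * V)ᵀ, hD, trace_transpose_mul]
    rw [norm_sq_eq_sum, Finset.mul_sum]
    refine Finset.sum_le_sum fun i _ => ?_
    rw [Finset.mul_sum]
    refine Finset.sum_le_sum fun j _ => ?_
    rw [Matrix.diagonal_mul]
    have := pow_le_pow_left₀ hs (hM i i.2) 2
    nlinarith [mul_le_mul_of_nonneg_right this (sq_nonneg ((Vᵀ * B) i j))]
  calc s * ‖A * M * B‖ ≤ s * (‖A * M * V‖ * ‖Vᵀ * B‖) := by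
        rw [h1]; gcongr; exact Matrix.frobenius_norm_mul _ _
    _ = ‖A * M * V‖ * (s * ‖Vᵀ * B‖) := by ring
    _ ≤ ‖A * M‖ * ‖M * B‖ := by
        gcongr
        exact norm_mul_orthonormal_le hV _

theorem norm_sq_le_of_singularValues_le {s : ℝ} (hk : M.rank = k)
    (hM : ∀ i < k, (Matrix.toEuclideanLin M).singularValues i ≤ s) :
    ‖M‖ ^ 2 ≤ k * s ^ 2 := by
  obtain ⟨V, hV, hMV, hD⟩ := exists_right_singular hk
  rw [← hMV, norm_mul_orthonormal_transpose hV, norm_sq_eq_trace, hD, Matrix.trace_diagonal]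
  calc _ ≤ ∑ _i : Fin k, s ^ 2 := Finset.sum_le_sum fun i _ =>
        pow_le_pow_left₀ (LinearMap.singularValues_nonneg _ _) (hM i i.2) 2
    _ = _ := by simp

theorem exists_orthonormal_columns (hk : M.rank = k) :
    ∃ Q : Matrix (Fin m) (Fin k) ℝ, Qᵀ * Q = 1 ∧ Q * (Qᵀ * M) = M := by
  have hk' : Mᵀ.rank = k := by rw [Matrix.rank_transpose, hk]
  obtain ⟨Q, hQ, hMQ, -⟩ := exists_right_singular hk'
  refine ⟨Q, hQ, ?_⟩
  have := congrArg Matrix.transpose hMQ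
  simpa [Matrix.transpose_mul] using this

end ThinSVD

/-! ### Restricted isometry and spectral initialization. -/

section Initialization

variable {m n p k : ℕ} {A : Fin p → Matrix (Fin m) (Fin n) ℝ}

theorem rank_add_le (M N : Matrix (Fin m) (Fin n) ℝ) : (M + N).rank ≤ M.rank + N.rank := by
  unfold Matrix.rank
  refine le_trans (Submodule.finrank_mono ?_) (Submodule.finrank_add_le_finrank_add_finrank _ _)
  rw [Matrix.mulVecLin_add]
  exact LinearMap.range_add_le _ _

theorem measure_add_smul (M N : Matrix (Fin m) (Fin n) ℝ) (s : ℝ) :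
    measure A (M + s • N) = measure A M + s • measure A N := by
  ext i
  simp [measure, Matrix.mul_add]

theorem trace_sum_smul_transpose_mul (b : EuclideanSpace ℝ (Fin p))
    (W : Matrix (Fin m) (Fin n) ℝ) :
    ((∑ i, b i • A i)ᵀ * W).trace = inner ℝ b (measure A W) := by
  simp [measure, PiLp.inner_apply, Matrix.transpose_sum, Matrix.sum_mul, Matrix.trace_sum, mul_comm]

/-- A nearly isometric map nearly preserves inner products. -/
theorem RIP.inner_sub_trace_le {δ : ℝ} {r : ℕ} (hA : RIP r δ A) {M W : Matrix (Fin m) (Fin n) ℝ}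
    (hr : ∀ s : ℝ, (M + s • W).rank ≤ r) (s : ℝ) :
    2 * s * (inner ℝ (measure A M) (measure A W) - (Mᵀ * W).trace) ≤
      δ * (‖M‖ ^ 2 + s ^ 2 * ‖W‖ ^ 2) := by
  have h1 := (hA _ (hr s)).2
  have h2 := (hA _ (hr (-s))).1
  have h3 := norm_add_sq_real (measure A M) (s • measure A W)
  have h4 := norm_add_sq_real (measure A M) ((-s) • measure A W)
  rw [measure_add_smul, norm_add_smul_sq] at h1 h2
  simp only [inner_smul_right, norm_smul, mul_pow, norm_neg, Real.norm_eq_abs, sq_abs] at h3 h4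
  rw [h3] at h1
  rw [h4] at h2
  linarith

/-- Projecting onto `k` leading left singular vectors captures most of the Frobenius norm. -/
theorem IsTopSVD.norm_transpose_mul_le {B : Matrix (Fin m) (Fin n) ℝ}
    {X : Matrix (Fin m) (Fin k) ℝ} {D : Matrix (Fin k) (Fin k) ℝ} {Y : Matrix (Fin n) (Fin k) ℝ}
    (h : IsTopSVD B X D Y) {Q : Matrix (Fin m) (Fin k) ℝ} (hQ : Qᵀ * Q = 1) :
    Xᵀ * X = 1 ∧ ‖Qᵀ * B‖ ≤ ‖Xᵀ * B‖ := by
  obtain ⟨U, s, V, hm, hn, ⟨hU, hV, hanti, hs, hB⟩, hX, -, -⟩ := h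
  have hUU : Uᵀ * U = 1 := by simpa [Matrix.star_eq_conjTranspose] using hU.1
  have hUU' : U * Uᵀ = 1 := mul_eq_one_comm.mp hUU
  have hVV : Vᵀ * V = 1 := by simpa [Matrix.star_eq_conjTranspose] using hV.1
  have hXX : Xᵀ * X = 1 := by
    ext i j
    have := congrFun₂ hUU (Fin.castLE hm i) (Fin.castLE hm j)
    rw [hX]
    simpa [Matrix.mul_apply, Matrix.one_apply] using this
  refine ⟨hXX, ?_⟩
  -- Eigenvalues of `B Bᵀ`. Each squared norm `‖Zᵀ * B‖ ^ 2` is a sum of the `τ i` with weights in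
  -- `[0, 1]` of total `k`; the weights of `X` fill the first `k` places.
  set τ : Fin m → ℝ := fun i => if (i : ℕ) < n then s i ^ 2 else 0 with hτ
  have key : ∀ Z : Matrix (Fin m) (Fin k) ℝ,
      ‖Zᵀ * B‖ ^ 2 = ∑ i, (∑ a, (Zᵀ * U) a i ^ 2) * τ i := by
    intro Z
    rw [hB, ← Matrix.mul_assoc, norm_mul_orthonormal_transpose hVV, ← Matrix.mul_assoc,
      norm_sq_eq_sum]
    simp only [Finset.sum_mul]
    rw [Finset.sum_comm (s := (Finset.univ : Finset (Fin m)))]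
    refine Finset.sum_congr rfl fun a _ => ?_
    have h1 : ∀ j : Fin n, ((Zᵀ * U) * (Matrix.of fun (i : Fin m) (j : Fin n) =>
        if (i : ℕ) = j then s i else 0)) a j ^ 2 =
        ∑ i : Fin m, if (i : ℕ) = j then ((Zᵀ * U) a i) ^ 2 * s i ^ 2 else 0 := by
      intro j
      rw [Matrix.mul_apply]
      by_cases hj : (j : ℕ) < m
      · rw [Finset.sum_eq_single ⟨j, hj⟩, Finset.sum_eq_single ⟨j, hj⟩]
        · simp [mul_pow]
        · intro i _ hi
          rw [if_neg]
          exact fun h => hi (Fin.ext h)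
        · simp
        · intro i _ hi
          simp only [Matrix.of_apply]
          rw [if_neg, mul_zero]
          exact fun h => hi (Fin.ext h)
        · simp
      · have : ∀ i : Fin m, (i : ℕ) ≠ j := fun i h => hj (h ▸ i.2)
        simp [this]
    rw [Finset.sum_congr rfl fun j _ => h1 j, Finset.sum_comm]
    refine Finset.sum_congr rfl fun i _ => ?_
    by_cases hi : (i : ℕ) < n
    · rw [Finset.sum_eq_single ⟨i, hi⟩]
      · simp [hτ, hi]
      · intro j _ hj
        rw [if_neg]
        exact fun h => hj (Fin.ext h.symm)
      · simp
    · have : ∀ j : Fin n, (i : ℕ) ≠ j := fun j h => hi (h ▸ j.2)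
      simp [hτ, hi, this]
  have hsum : ∀ Z : Matrix (Fin m) (Fin k) ℝ, Zᵀ * Z = 1 →
      ∑ i, ∑ a, (Zᵀ * U) a i ^ 2 = k := by
    intro Z hZ
    rw [Finset.sum_comm, ← norm_sq_eq_sum, ← Matrix.frobenius_norm_transpose,
      Matrix.transpose_mul, Matrix.transpose_transpose, norm_sq_eq_trace, Matrix.transpose_mul,
      Matrix.transpose_transpose, Matrix.mul_assoc, ← Matrix.mul_assoc U, hUU', Matrix.one_mul, hZ]
    simp
  have hle : ∀ i, ∑ a, (Qᵀ * U) a i ^ 2 ≤ 1 := by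
    intro i
    have h1 := norm_transpose_orthonormal_mul_le hQ (U.submatrix id fun _ : Fin 1 => i)
    rw [← sq_le_sq₀ (norm_nonneg _) (norm_nonneg _), norm_sq_eq_sum, norm_sq_eq_sum] at h1
    have h2 := congrFun₂ hUU i i
    rw [Matrix.mul_apply] at h2
    simp only [Matrix.transpose_apply, Matrix.one_apply_eq, ← sq] at h2
    simp only [Matrix.mul_apply, Matrix.submatrix_apply, id, Fin.sum_univ_one, h2] at h1
    simpa only [Matrix.mul_apply] using h1
  have hXU : ∀ i, ∑ a, (Xᵀ * U) a i ^ 2 = if (i : ℕ) < k then 1 else 0 := by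
    intro i
    have h1 : ∀ a, (Xᵀ * U) a i = if Fin.castLE hm a = i then 1 else 0 := by
      intro a
      have := congrFun₂ hUU (Fin.castLE hm a) i
      rw [hX]
      simpa [Matrix.mul_apply, Matrix.one_apply] using this
    simp only [h1]
    by_cases hi : (i : ℕ) < k
    · rw [Finset.sum_eq_single ⟨i, hi⟩]
      · simp [hi]
      · intro a _ ha
        rw [if_neg]
        · simp
        · exact fun h => ha (Fin.ext (by simpa using congrArg Fin.val h))
      · simp
    · rw [if_neg hi]
      refine Finset.sum_eq_zero fun a _ => ?_
      rw [if_neg]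
      · simp
      · rintro rfl
        exact hi a.2
  rw [← sq_le_sq₀ (norm_nonneg _) (norm_nonneg _), key Q, key X]
  -- Subtracting the threshold `s (k - 1) ^ 2` makes every term nonpositive: both factors change
  -- sign at index `k`. The threshold itself cancels because the two weight totals agree.
  have hdiff : ∑ i, (∑ a, (Qᵀ * U) a i ^ 2 - ∑ a, (Xᵀ * U) a i ^ 2) * (τ i - s (k - 1) ^ 2) ≤ 0 := by
    refine Finset.sum_nonpos fun i _ => ?_
    rw [hXU i]
    have hnn : 0 ≤ ∑ a, (Qᵀ * U) a i ^ 2 := Finset.sum_nonneg fun _ _ => sq_nonneg _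
    by_cases hi : (i : ℕ) < k
    · rw [if_pos hi]
      refine mul_nonpos_of_nonpos_of_nonneg (by linarith [hle i]) ?_
      simp only [hτ, if_pos (hi.trans_le hn), sub_nonneg]
      exact pow_le_pow_left₀ (hs _) (hanti (by omega)) 2
    · rw [if_neg hi, sub_zero]
      refine mul_nonpos_of_nonneg_of_nonpos hnn ?_
      have : τ i ≤ s i ^ 2 := by
        simp only [hτ]
        split_ifs
        · exact le_rfl
        · positivity
      linarith [pow_le_pow_left₀ (hs i) (hanti (show k - 1 ≤ i by omega)) 2]
  have h0 : ∑ i, (∑ a, (Qᵀ * U) a i ^ 2 - ∑ a, (Xᵀ * U) a i ^ 2) * s (k - 1) ^ 2 = 0 := by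
    rw [← Finset.sum_mul, Finset.sum_sub_distrib, hsum Q hQ, hsum X hXX, sub_self, zero_mul]
  simp only [mul_sub, sub_mul, Finset.sum_sub_distrib] at hdiff h0
  linarith

/-- Spectral initialization from measurements with the restricted isometry property. -/
theorem IsTopSVD.norm_sub_proj_le {δ : ℝ} (hδ : 0 < δ) (hA : RIP (2 * k) δ A)
    {M : Matrix (Fin m) (Fin n) ℝ} (hk : M.rank = k)
    {X : Matrix (Fin m) (Fin k) ℝ} {D : Matrix (Fin k) (Fin k) ℝ} {Y : Matrix (Fin n) (Fin k) ℝ}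
    (h : IsTopSVD (∑ i, measure A M i • A i) X D Y) :
    ‖M - X * (Xᵀ * M)‖ ≤ 2 * δ * ‖M‖ := by
  set B := ∑ i, measure A M i • A i with hB
  obtain ⟨Q, hQ, hQM⟩ := exists_orthonormal_columns hk
  obtain ⟨hX, hle⟩ := h.norm_transpose_mul_le hQ
  set W := X * (Xᵀ * B) - M with hW
  -- The truncated decomposition approximates `B` at least as well as `M` does.
  have hbest : ‖B - X * (Xᵀ * B)‖ ^ 2 ≤ ‖B - M‖ ^ 2 := by
    have h1 : (B - M) - Q * (Qᵀ * (B - M)) = B - Q * (Qᵀ * B) := by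
      simp only [Matrix.mul_sub, hQM]
      abel
    have h2 := EMF.norm_sub_proj_le hQ (B - M)
    rw [h1] at h2
    calc ‖B - X * (Xᵀ * B)‖ ^ 2 = ‖B‖ ^ 2 - ‖Xᵀ * B‖ ^ 2 := norm_sub_proj_sq hX B
      _ ≤ ‖B‖ ^ 2 - ‖Qᵀ * B‖ ^ 2 := by gcongr
      _ = ‖B - Q * (Qᵀ * B)‖ ^ 2 := (norm_sub_proj_sq hQ B).symm
      _ ≤ ‖B - M‖ ^ 2 := by gcongr
  have hWle : ‖W‖ ^ 2 ≤ 2 * ((inner ℝ (measure A M) (measure A W)) - (Mᵀ * W).trace) := by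
    have h1 : B - X * (Xᵀ * B) = (B - M) - W := by rw [hW]; abel
    rw [h1, norm_sub_sq_eq] at hbest
    rw [← trace_sum_smul_transpose_mul, ← hB, ← Matrix.trace_sub, ← Matrix.sub_mul,
      ← Matrix.transpose_sub]
    linarith
  -- The column space lies in the sum of those of `Q` and `X`, which is why RIP of order `2k`
  -- suffices.
  have hrank : ∀ s : ℝ, (M + s • W).rank ≤ 2 * k := by
    intro s
    have h1 : M + s • W = Q * ((1 - s) • (Qᵀ * M)) + X * (s • (Xᵀ * B)) := by
      rw [Matrix.mul_smul, Matrix.mul_smul, hQM, hW, smul_sub, sub_smul, one_smul]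
      abel
    rw [h1]
    refine (rank_add_le _ _).trans ?_
    have h2 := (Matrix.rank_mul_le_left Q ((1 - s) • (Qᵀ * M))).trans Q.rank_le_width
    have h3 := (Matrix.rank_mul_le_left X (s • (Xᵀ * B))).trans X.rank_le_width
    omega
  have hWn : ‖W‖ ≤ 2 * δ * ‖M‖ := by
    -- This step size gives `‖W‖ ^ 2 ≤ 2 δ ^ 2 ‖M‖ ^ 2 + ‖W‖ ^ 2 / 2`, whose last term is absorbed
    -- on the left.
    have h1 := hA.inner_sub_trace_le hrank (1 / (2 * δ))
    rw [← sq_le_sq₀ (norm_nonneg _) (by positivity)]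
    have h2 : 2 * (1 / (2 * δ)) * (inner ℝ (measure A M) (measure A W) - (Mᵀ * W).trace) =
      (inner ℝ (measure A M) (measure A W) - (Mᵀ * W).trace) / δ := by field_simp
    have h3 : δ * (‖M‖ ^ 2 + (1 / (2 * δ)) ^ 2 * ‖W‖ ^ 2) =
      (δ ^ 2 * ‖M‖ ^ 2 + ‖W‖ ^ 2 / 4) / δ := by field_simp; ring
    rw [h2, h3, div_le_div_iff_of_pos_right hδ] at h1
    nlinarith
  have hG : M - X * (Xᵀ * M) = -(W - X * (Xᵀ * W)) := by
    have : Xᵀ * (X * (Xᵀ * B)) = Xᵀ * B := by rw [← Matrix.mul_assoc, hX, Matrix.one_mul]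
    simp only [hW, Matrix.mul_sub, this]
    abel
  rw [hG, norm_neg]
  exact (EMF.norm_sub_proj_le hX W).trans hWn

end Initialization

/-! ### Smoothness and growth of the asymmetric loss. -/

section Loss

variable {ω : ℝ} {p : ℕ}

/-- The weight `|ω - 1(t < 0)|` of a residual `t` in the asymmetric least squares loss. -/
noncomputable def asymWeight (ω t : ℝ) : ℝ := |ω - (if t < 0 then 1 else 0)|

theorem asymSq_eq (t : ℝ) : asymSq ω t = asymWeight ω t * t * t := by
  unfold asymSq asymWeight; ring

theorem asymWeight_eq (h0 : 0 < ω) (h1 : ω < 1) (t : ℝ) :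
    asymWeight ω t = if t < 0 then 1 - ω else ω := by
  unfold asymWeight
  split_ifs
  · rw [abs_sub_comm, abs_of_pos (by linarith)]
  · rw [sub_zero, abs_of_pos h0]

theorem min_le_asymWeight (h0 : 0 < ω) (h1 : ω < 1) (t : ℝ) :
    min ω (1 - ω) ≤ asymWeight ω t := by
  rw [asymWeight_eq h0 h1]; split_ifs <;> simp

theorem asymWeight_le_max (h0 : 0 < ω) (h1 : ω < 1) (t : ℝ) :
    asymWeight ω t ≤ max ω (1 - ω) := by
  rw [asymWeight_eq h0 h1]; split_ifs <;> simp

/-- The derivative of the loss is Lipschitz with constant `2 * max ω (1 - ω)`. When the step changes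
the sign of the residual, `(t - h) ^ 2 ≤ h ^ 2` pays for the change of weight. -/
theorem asymSq_sub_le (h0 : 0 < ω) (h1 : ω < 1) (t h : ℝ) :
    asymSq ω (t - h) ≤ asymSq ω t - 2 * (asymWeight ω t * t * h) + max ω (1 - ω) * h ^ 2 := by
  have hl := le_max_left ω (1 - ω)
  have hr := le_max_right ω (1 - ω)
  set b := max ω (1 - ω)
  rw [asymSq_eq, asymSq_eq, asymWeight_eq h0 h1, asymWeight_eq h0 h1]
  split_ifs with h2 h3 h3
  · nlinarith [mul_nonneg (sub_nonneg.mpr hr) (sq_nonneg h)]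
  · have : (t - h) ^ 2 ≤ h ^ 2 := by nlinarith
    nlinarith [mul_nonneg (sub_nonneg.mpr hl) (sub_nonneg.mpr this),
      mul_nonneg (sub_nonneg.mpr hr) (sq_nonneg (t - h))]
  · have : (t - h) ^ 2 ≤ h ^ 2 := by nlinarith
    nlinarith [mul_nonneg (sub_nonneg.mpr hr) (sub_nonneg.mpr this),
      mul_nonneg (sub_nonneg.mpr hl) (sq_nonneg (t - h))]
  · nlinarith [mul_nonneg (sub_nonneg.mpr hl) (sq_nonneg h)]

/-- The total asymmetric loss of a vector of residuals. -/
noncomputable def loss (ω : ℝ) (v : EuclideanSpace ℝ (Fin p)) : ℝ := ∑ i, asymSq ω (v i)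

/-- Half the derivative of the total loss at `v` in the direction `h`. -/
noncomputable def lossSlope (ω : ℝ) (v h : EuclideanSpace ℝ (Fin p)) : ℝ :=
  ∑ i, asymWeight ω (v i) * v i * h i

theorem lossSlope_self (v : EuclideanSpace ℝ (Fin p)) : lossSlope ω v v = loss ω v := by
  simp only [lossSlope, loss, asymSq_eq]

theorem lossSlope_add (v h g : EuclideanSpace ℝ (Fin p)) :
    lossSlope ω v (h + g) = lossSlope ω v h + lossSlope ω v g := by
  simp only [lossSlope, PiLp.add_apply, mul_add, Finset.sum_add_distrib]

theorem min_mul_sq_le_loss (h0 : 0 < ω) (h1 : ω < 1) (v : EuclideanSpace ℝ (Fin p)) :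
    min ω (1 - ω) * ‖v‖ ^ 2 ≤ loss ω v := by
  rw [EuclideanSpace.real_norm_sq_eq, Finset.mul_sum, loss]
  refine Finset.sum_le_sum fun i _ => ?_
  rw [asymSq_eq, mul_assoc, ← sq]
  exact mul_le_mul_of_nonneg_right (min_le_asymWeight h0 h1 _) (sq_nonneg _)

theorem loss_le_max_mul_sq (h0 : 0 < ω) (h1 : ω < 1) (v : EuclideanSpace ℝ (Fin p)) :
    loss ω v ≤ max ω (1 - ω) * ‖v‖ ^ 2 := by
  rw [EuclideanSpace.real_norm_sq_eq, Finset.mul_sum, loss]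
  refine Finset.sum_le_sum fun i _ => ?_
  rw [asymSq_eq, mul_assoc, ← sq]
  exact mul_le_mul_of_nonneg_right (asymWeight_le_max h0 h1 _) (sq_nonneg _)

theorem loss_sub_smul_le (h0 : 0 < ω) (h1 : ω < 1) (v h : EuclideanSpace ℝ (Fin p)) (s : ℝ) :
    loss ω (v - s • h) ≤
      loss ω v - 2 * s * lossSlope ω v h + s ^ 2 * (max ω (1 - ω) * ‖h‖ ^ 2) := by
  rw [EuclideanSpace.real_norm_sq_eq, loss, loss, lossSlope, Finset.mul_sum, Finset.mul_sum,
    Finset.mul_sum, ← Finset.sum_sub_distrib, ← Finset.sum_add_distrib]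
  refine Finset.sum_le_sum fun i _ => ?_
  have := asymSq_sub_le h0 h1 (v i) (s * h i)
  simp only [PiLp.sub_apply, PiLp.smul_apply, smul_eq_mul]
  linarith

/-- Cauchy–Schwarz for the inner product weighted by the `asymWeight ω (v i)`. -/
theorem lossSlope_sq_le (h0 : 0 < ω) (h1 : ω < 1) (v h : EuclideanSpace ℝ (Fin p)) :
    lossSlope ω v h ^ 2 ≤ loss ω v * (max ω (1 - ω) * ‖h‖ ^ 2) := by
  have hw : ∀ t, 0 ≤ asymWeight ω t := fun t => abs_nonneg _
  calc lossSlope ω v h ^ 2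
      ≤ (∑ i, asymWeight ω (v i) * v i ^ 2) * ∑ i, asymWeight ω (v i) * h i ^ 2 :=
        Finset.sum_sq_le_sum_mul_sum_of_sq_le_mul _
          (fun i _ => mul_nonneg (hw _) (sq_nonneg _))
          (fun i _ => mul_nonneg (hw _) (sq_nonneg _)) fun i _ => le_of_eq (by ring)
    _ ≤ loss ω v * (max ω (1 - ω) * ‖h‖ ^ 2) := by
        have hl : loss ω v = ∑ i, asymWeight ω (v i) * v i ^ 2 := by
          simp only [loss, asymSq_eq, sq, mul_assoc]
        rw [← hl]
        refine mul_le_mul_of_nonneg_left ?_ (hl ▸ Finset.sum_nonneg fun i _ =>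
          mul_nonneg (hw _) (sq_nonneg _))
        rw [EuclideanSpace.real_norm_sq_eq, Finset.mul_sum]
        exact Finset.sum_le_sum fun i _ =>
          mul_le_mul_of_nonneg_right (asymWeight_le_max h0 h1 _) (sq_nonneg _)

theorem lossSlope_eq_zero (h0 : 0 < ω) (h1 : ω < 1) {v h : EuclideanSpace ℝ (Fin p)}
    (hmin : ∀ s : ℝ, loss ω v ≤ loss ω (v - s • h)) : lossSlope ω v h = 0 := by
  set g := lossSlope ω v h
  set c := max ω (1 - ω) * ‖h‖ ^ 2 with hc
  have hc0 : 0 ≤ c := mul_nonneg (h0.le.trans (le_max_left _ _)) (sq_nonneg _)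
  -- A step proportional to the slope would lower the loss; `c + 1` in place of `c` covers `c = 0`.
  have h2 : 0 ≤ -2 * (g / (c + 1)) * g + (g / (c + 1)) ^ 2 * c := by
    linarith [(hmin (g / (c + 1))).trans (loss_sub_smul_le h0 h1 v h _)]
  have h3 : -2 * (g / (c + 1)) * g + (g / (c + 1)) ^ 2 * c = -(g ^ 2 * (c + 2)) / (c + 1) ^ 2 := by
    field_simp; ring
  rw [h3, le_div_iff₀ (by positivity)] at h2
  have h4 : g ^ 2 ≤ 0 := by nlinarith [sq_nonneg g]
  exact pow_eq_zero_iff two_ne_zero |>.mp (le_antisymm h4 (sq_nonneg g))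

end Loss

/-! ### One half-step decreases the loss by a fixed proportion. -/

section Descent

variable {ω δ : ℝ} {m n p k : ℕ} {A : Fin p → Matrix (Fin m) (Fin n) ℝ}
  {M : Matrix (Fin m) (Fin n) ℝ}

theorem measure_add (M N : Matrix (Fin m) (Fin n) ℝ) :
    measure A (M + N) = measure A M + measure A N := by
  simpa using measure_add_smul M N 1

theorem measure_sub_smul (M N : Matrix (Fin m) (Fin n) ℝ) (s : ℝ) :
    measure A (M - s • N) = measure A M - s • measure A N := by
  simpa [sub_eq_add_neg] using measure_add_smul M N (-s)

theorem objective_measure (X : Matrix (Fin m) (Fin k) ℝ) (Y : Matrix (Fin n) (Fin k) ℝ) :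
    objective ω A (measure A M) X Y = loss ω (measure A (M - X * Yᵀ)) := by
  have := measure_sub_smul (A := A) M (X * Yᵀ) 1
  rw [one_smul, one_smul] at this
  rw [this]
  rfl

theorem rank_sub_mul_transpose_le (hk : M.rank = k) (X : Matrix (Fin m) (Fin k) ℝ)
    (Y : Matrix (Fin n) (Fin k) ℝ) : (M - X * Yᵀ).rank ≤ 2 * k := by
  rw [sub_eq_add_neg, ← Matrix.neg_mul]
  refine (rank_add_le _ _).trans ?_
  have := (Matrix.rank_mul_le_left (-X) Yᵀ).trans (-X).rank_le_width
  omega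

/-- A minimizer over one factor can be improved by a constant proportion by changing the other
factor, if the residual is small. -/
theorem exists_objective_le (h0 : 0 < ω) (h1 : ω < 1) (hδ : δ ≤ 1 / 2) (hA : RIP (2 * k) δ A)
    (hk : M.rank = k) {s r : ℝ} (hs : 0 < s)
    (hM : ∀ i < k, s ≤ (Matrix.toEuclideanLin M).singularValues i)
    (hr : r = min ω (1 - ω) / max ω (1 - ω))
    {X : Matrix (Fin m) (Fin k) ℝ} {Y Q : Matrix (Fin n) (Fin k) ℝ} {R : Matrix (Fin k) (Fin k) ℝ}
    (hX : Xᵀ * X = 1) (hQ : Qᵀ * Q = 1) (hY : Y = Q * R)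
    (hmin : ∀ Z : Matrix (Fin n) (Fin k) ℝ,
      objective ω A (measure A M) X Y ≤ objective ω A (measure A M) X Z)
    (hsmall : ‖M - X * Yᵀ‖ ^ 2 ≤ s ^ 2 * r / 12) :
    ∃ X' : Matrix (Fin m) (Fin k) ℝ, objective ω A (measure A M) X' Q ≤
      (1 - r / 12) * objective ω A (measure A M) X Y := by
  simp only [objective_measure] at hmin ⊢
  have ha : 0 < min ω (1 - ω) := lt_min h0 (by linarith)
  have hb : 0 < max ω (1 - ω) := lt_max_of_lt_left h0
  have hlow := min_mul_sq_le_loss h0 h1 (measure A (M - X * Yᵀ))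
  have hdesc := loss_sub_smul_le h0 h1 (measure A (M - X * Yᵀ))
  have hcs := lossSlope_sq_le h0 h1 (measure A (M - X * Yᵀ))
  -- First-order optimality of `Y`: moving along `X * Z` only changes the right factor.
  have hzero : ∀ Z : Matrix (Fin k) (Fin n) ℝ,
      lossSlope ω (measure A (M - X * Yᵀ)) (measure A (X * Z)) = 0 := by
    intro Z
    refine lossSlope_eq_zero h0 h1 fun t => ?_
    have h2 : M - X * Yᵀ - t • (X * Z) = M - X * (Y + t • Zᵀ)ᵀ := by
      simp only [Matrix.transpose_add, Matrix.transpose_smul, Matrix.transpose_transpose,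
        Matrix.mul_add, Matrix.mul_smul]
      abel
    rw [← measure_sub_smul, h2]
    exact hmin _
  have hNr := rank_sub_mul_transpose_le hk X Y
  set a := min ω (1 - ω)
  set b := max ω (1 - ω)
  set N := M - X * Yᵀ with hN
  set G := N - X * (Xᵀ * N) with hG
  set H := G * Q * Qᵀ with hH
  set S := G - H with hS
  set L := loss ω (measure A N) with hL
  have hGM : G = (1 - X * Xᵀ) * M := by
    have h2 : Xᵀ * (X * Yᵀ) = Yᵀ := by rw [← Matrix.mul_assoc, hX, Matrix.one_mul]
    rw [hG, hN, Matrix.mul_sub, h2, Matrix.sub_mul, Matrix.one_mul, Matrix.mul_assoc,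
      Matrix.mul_sub]
    abel
  have hNQ : N - N * Q * Qᵀ = M * (1 - Q * Qᵀ) := by
    have h2 : X * Yᵀ * Q * Qᵀ = X * Yᵀ := by
      rw [hY, Matrix.transpose_mul, Matrix.mul_assoc, Matrix.mul_assoc, Matrix.mul_assoc,
        ← Matrix.mul_assoc Qᵀ, hQ, Matrix.one_mul]
    rw [hN, Matrix.sub_mul, Matrix.sub_mul, h2, Matrix.mul_sub, Matrix.mul_one, Matrix.mul_assoc]
    abel
  have hSM : S = (1 - X * Xᵀ) * M * (1 - Q * Qᵀ) := by
    rw [hS, hH, hGM, Matrix.mul_sub, Matrix.mul_one, Matrix.mul_assoc _ Q]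
  have hGN : ‖G‖ ≤ ‖N‖ := norm_sub_proj_le hX N
  have hHN : ‖H‖ ≤ ‖N‖ := by
    rw [hH, norm_mul_orthonormal_transpose hQ]
    exact (norm_mul_orthonormal_le hQ G).trans hGN
  have hSN : s * ‖S‖ ≤ ‖N‖ ^ 2 := by
    rw [hSM, sq]
    refine (mul_norm_mul_mul_le hs.le hk hM _ _).trans ?_
    rw [← hGM, ← hNQ]
    gcongr
    exact norm_sub_mul_proj_le hQ N
  have hHr : H.rank ≤ 2 * k := by
    have : H.rank ≤ k := (Matrix.rank_mul_le_right (G * Q) Qᵀ).trans Qᵀ.rank_le_height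
    omega
  have hSr : S.rank ≤ 2 * k := by
    have := (Matrix.rank_mul_le_left ((1 - X * Xᵀ) * M) (1 - Q * Qᵀ)).trans
      (Matrix.rank_mul_le_right (1 - X * Xᵀ) M)
    rw [hSM]
    omega
  have hup : ∀ Z : Matrix (Fin m) (Fin n) ℝ, Z.rank ≤ 2 * k →
      ‖measure A Z‖ ^ 2 ≤ 3 / 2 * ‖Z‖ ^ 2 := fun Z hZ =>
    (hA Z hZ).2.trans (mul_le_mul_of_nonneg_right (by linarith) (sq_nonneg _))
  have hLN : a * ‖N‖ ^ 2 ≤ 2 * L := by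
    have h2 : 1 / 2 * ‖N‖ ^ 2 ≤ ‖measure A N‖ ^ 2 :=
      (mul_le_mul_of_nonneg_right (by linarith) (sq_nonneg _)).trans (hA N hNr).1
    nlinarith
  have hL0 : 0 ≤ L := by nlinarith [mul_nonneg ha.le (sq_nonneg ‖N‖)]
  have hbr : b * r = a := by rw [hr]; field_simp
  have hr0 : 0 < r := by rw [hr]; positivity
  have hsplit : lossSlope ω (measure A N) (measure A H) +
      lossSlope ω (measure A N) (measure A S) = L := by
    have h2 : N = X * (Xᵀ * N) + (H + S) := by rw [hS, hG]; abel
    conv_rhs => rw [hL, ← lossSlope_self]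
    conv_rhs => arg 3; rw [h2]
    rw [measure_add, measure_add, lossSlope_add, lossSlope_add, hzero, zero_add]
  have hslopeS : lossSlope ω (measure A N) (measure A S) ≤ L / 2 := by
    have h2 : s ^ 2 * ‖S‖ ^ 2 ≤ s ^ 2 * (r / 12 * ‖N‖ ^ 2) := by
      have := pow_le_pow_left₀ (by positivity) hSN 2
      nlinarith [sq_nonneg ‖N‖]
    have h3 : ‖S‖ ^ 2 ≤ r / 12 * ‖N‖ ^ 2 := le_of_mul_le_mul_left h2 (by positivity)
    have h4 : b * ‖measure A S‖ ^ 2 ≤ L / 4 := by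
      calc b * ‖measure A S‖ ^ 2 ≤ b * (3 / 2 * (r / 12 * ‖N‖ ^ 2)) := by
            gcongr
            exact (hup S hSr).trans (by gcongr)
        _ = b * r * ‖N‖ ^ 2 / 8 := by ring
        _ ≤ L / 4 := by rw [hbr]; linarith
    refine abs_le_of_sq_le_sq' ?_ (by positivity) |>.2
    exact (hcs _).trans ((mul_le_mul_of_nonneg_left h4 hL0).trans (by linarith [sq L]))
  -- `X * Rᵀ` reproduces `X * Yᵀ` in the frame `Q`. With step `r / 6` the linear gain is at least `r
  -- L / 6` and the quadratic cost at most `r L / 12`.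
  refine ⟨X * Rᵀ + (r / 6) • (G * Q), ?_⟩
  have hres : M - (X * Rᵀ + (r / 6) • (G * Q)) * Qᵀ = N - (r / 6) • H := by
    rw [hN, hH, Matrix.add_mul, Matrix.smul_mul, hY, Matrix.transpose_mul, Matrix.mul_assoc]
    abel
  rw [hres, measure_sub_smul]
  refine (hdesc _ _).trans ?_
  have h5 : r ^ 2 * (b * ‖measure A H‖ ^ 2) ≤ 3 * r * L := by
    calc r ^ 2 * (b * ‖measure A H‖ ^ 2) ≤ r ^ 2 * (b * (3 / 2 * ‖N‖ ^ 2)) := by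
          gcongr
          exact (hup H hHr).trans (by gcongr)
      _ = 3 / 2 * r * (b * r * ‖N‖ ^ 2) := by ring
      _ ≤ 3 / 2 * r * (2 * L) := by rw [hbr]; gcongr
      _ = 3 * r * L := by ring
  have h6 : L / 2 ≤ lossSlope ω (measure A N) (measure A H) := by linarith
  nlinarith [mul_le_mul_of_nonneg_left h6 hr0.le]

end Descent

/-! ### Linear convergence of the iterates. -/

section Convergence

variable {ω δ : ℝ} {m n p k : ℕ} {A : Fin p → Matrix (Fin m) (Fin n) ℝ}
  {M : Matrix (Fin m) (Fin n) ℝ}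

theorem norm_sq_residual_le (h0 : 0 < ω) (h1 : ω < 1) (hδ : δ ≤ 1 / 2) (hA : RIP (2 * k) δ A)
    (hk : M.rank = k) (X : Matrix (Fin m) (Fin k) ℝ) (Y : Matrix (Fin n) (Fin k) ℝ) :
    min ω (1 - ω) * ‖M - X * Yᵀ‖ ^ 2 ≤ 2 * objective ω A (measure A M) X Y := by
  have ha : 0 < min ω (1 - ω) := lt_min h0 (by linarith)
  have h2 : 1 / 2 * ‖M - X * Yᵀ‖ ^ 2 ≤ ‖measure A (M - X * Yᵀ)‖ ^ 2 :=
    (mul_le_mul_of_nonneg_right (by linarith) (sq_nonneg _)).trans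
      (hA _ (rank_sub_mul_transpose_le hk X Y)).1
  rw [objective_measure]
  nlinarith [min_mul_sq_le_loss h0 h1 (measure A (M - X * Yᵀ))]

/-- Linear convergence of alternating minimization from the spectral initialization. -/
theorem IsRun.norm_sq_residual_le (h0 : 0 < ω) (h1 : ω < 1) (hδ0 : 0 < δ) (hδ : δ ≤ 1 / 2)
    (hA : RIP (2 * k) δ A) (hk : M.rank = k) {s r : ℝ} (hs : 0 < s)
    (hM : ∀ i < k, s ≤ (Matrix.toEuclideanLin M).singularValues i)
    (hr : r = min ω (1 - ω) / max ω (1 - ω)) (hsmall : 144 * δ ^ 2 * ‖M‖ ^ 2 ≤ s ^ 2 * r ^ 2)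
    {T : ℕ} {Xbar Xhalf : ℕ → Matrix (Fin m) (Fin k) ℝ} {Ybar Yhalf : ℕ → Matrix (Fin n) (Fin k) ℝ}
    (hrun : IsRun ω A (measure A M) T Xbar Xhalf Ybar Yhalf) {t : ℕ} (ht : t < T) :
    r * ‖M - Xhalf t * (Ybar (t + 1))ᵀ‖ ^ 2 ≤
      (1 - r / 12) ^ (t + 1) * (12 * δ ^ 2 * ‖M‖ ^ 2) := by
  have ha : 0 < min ω (1 - ω) := lt_min h0 (by linarith)
  have hb : 0 < max ω (1 - ω) := lt_max_of_lt_left h0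
  have hr0 : 0 < r := by rw [hr]; positivity
  have hr1 : r ≤ 1 := by rw [hr, div_le_one hb]; exact min_le_max
  have hbr : max ω (1 - ω) * r = min ω (1 - ω) := by rw [hr]; field_simp
  obtain ⟨D, hD⟩ := hrun.init
  have hX0 : (Xbar 0)ᵀ * Xbar 0 = 1 := by
    obtain ⟨Q, hQ, -⟩ := exists_orthonormal_columns hk
    exact (hD.norm_transpose_mul_le hQ).1
  have hX : ∀ t < T, (Xbar t)ᵀ * Xbar t = 1 := by
    rintro (_ | t) ht
    · exact hX0
    · obtain ⟨R, hR⟩ := hrun.x_qr t (by omega)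
      exact hR.1
  -- Compare with `Y = Mᵀ * Xbar 0`, whose residual is the projection error of the initialization.
  have hinit : objective ω A (measure A M) (Xbar 0) (Yhalf 0) ≤
      max ω (1 - ω) * (6 * δ ^ 2 * ‖M‖ ^ 2) := by
    refine (hrun.y_step 0 (by omega) (Mᵀ * Xbar 0)).trans ?_
    rw [objective_measure, Matrix.transpose_mul, Matrix.transpose_transpose]
    refine (loss_le_max_mul_sq h0 h1 _).trans ?_
    gcongr
    have h2 : (M - Xbar 0 * ((Xbar 0)ᵀ * M)).rank ≤ 2 * k := by
      have := rank_sub_mul_transpose_le hk (Xbar 0) (Mᵀ * Xbar 0)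
      rwa [Matrix.transpose_mul, Matrix.transpose_transpose] at this
    have h3 := pow_le_pow_left₀ (norm_nonneg _) (hD.norm_sub_proj_le hδ0 hA hk) 2
    have h4 := (hA _ h2).2
    nlinarith [sq_nonneg ‖M - Xbar 0 * ((Xbar 0)ᵀ * M)‖]
  have hq0 : 0 ≤ 1 - r / 12 := by linarith
  have hq1 : 1 - r / 12 ≤ 1 := by linarith
  have hstep : ∀ t < T, objective ω A (measure A M) (Xbar t) (Yhalf t) ≤
      (1 - r / 12) ^ t * (max ω (1 - ω) * (6 * δ ^ 2 * ‖M‖ ^ 2)) →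
      objective ω A (measure A M) (Xhalf t) (Ybar (t + 1)) ≤
      (1 - r / 12) ^ (t + 1) * (max ω (1 - ω) * (6 * δ ^ 2 * ‖M‖ ^ 2)) := by
    intro t ht ih
    obtain ⟨R, hQ, -, hY⟩ := hrun.y_qr t ht
    -- The loss has not exceeded its initial bound, so `hsmall` keeps the residual in the basin of
    -- the descent step.
    have hN : ‖M - Xbar t * (Yhalf t)ᵀ‖ ^ 2 ≤ s ^ 2 * r / 12 := by
      have h2 := EMF.norm_sq_residual_le h0 h1 hδ hA hk (Xbar t) (Yhalf t)
      have h3 : (1 - r / 12) ^ t * (max ω (1 - ω) * (6 * δ ^ 2 * ‖M‖ ^ 2)) ≤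
          max ω (1 - ω) * (6 * δ ^ 2 * ‖M‖ ^ 2) :=
        mul_le_of_le_one_left (by positivity) (pow_le_one₀ hq0 hq1)
      have h4 : min ω (1 - ω) * ‖M - Xbar t * (Yhalf t)ᵀ‖ ^ 2 ≤
          min ω (1 - ω) * (s ^ 2 * r / 12) := by
        calc _ ≤ 2 * (max ω (1 - ω) * (6 * δ ^ 2 * ‖M‖ ^ 2)) := by linarith
          _ = max ω (1 - ω) * (144 * δ ^ 2 * ‖M‖ ^ 2) / 12 := by ring
          _ ≤ max ω (1 - ω) * (s ^ 2 * r ^ 2) / 12 := by gcongr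
          _ = max ω (1 - ω) * r * (s ^ 2 * r / 12) := by ring
          _ = _ := by rw [hbr]
      exact le_of_mul_le_mul_left h4 ha
    obtain ⟨X', hX'⟩ := exists_objective_le h0 h1 hδ hA hk hs hM hr (hX t ht) hQ hY
      (hrun.y_step t ht) hN
    refine (hrun.x_step t ht X').trans (hX'.trans ?_)
    rw [pow_succ', mul_assoc]
    gcongr
  have hall : ∀ t < T, objective ω A (measure A M) (Xbar t) (Yhalf t) ≤
      (1 - r / 12) ^ t * (max ω (1 - ω) * (6 * δ ^ 2 * ‖M‖ ^ 2)) := by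
    intro t
    induction t with
    | zero => intro _; simpa using hinit
    | succ t ih =>
      intro ht
      refine le_trans ?_ (hstep t (by omega) (ih (by omega)))
      obtain ⟨R, -, -, hR⟩ := hrun.x_qr t (by omega)
      -- Moving the triangular factor to the other side leaves the product unchanged, so
      -- orthonormalization costs nothing.
      refine (hrun.y_step (t + 1) ht (Ybar (t + 1) * Rᵀ)).trans (le_of_eq ?_)
      rw [objective_measure, objective_measure, Matrix.transpose_mul, Matrix.transpose_transpose,
        ← Matrix.mul_assoc, ← hR]
  have h5 := hstep t ht (hall t ht)
  have h6 := EMF.norm_sq_residual_le h0 h1 hδ hA hk (Xhalf t) (Ybar (t + 1))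
  refine le_of_mul_le_mul_left ?_ hb
  rw [← mul_assoc, hbr]
  linarith

end Convergence

end EMF

/-- Exact recovery by alternating minimization for expectile matrix factorization. The hidden
constant `c ω` of the iteration bound depends only on `ω`; the constants `C₃` and `C₄` depend only
on the bounds `smin`, `smax` for the singular values of the matrix to be recovered. -/
theorem theorem2 :
    ∃ c : ℝ → ℝ, (∀ ω : ℝ, 0 < c ω) ∧
      ∀ smin smax : ℝ, 0 < smin → smin ≤ smax →
        ∃ C₃ : ℝ, 0 < C₃ ∧ ∃ C₄ : ℝ, 0 < C₄ ∧
          ∀ (ω : ℝ), 0 < ω → ω < 1 →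
          ∀ (m n p k : ℕ), 1 ≤ k →
          ∀ (A : Fin p → Matrix (Fin m) (Fin n) ℝ) (Mstar : Matrix (Fin m) (Fin n) ℝ) (δ : ℝ),
            Mstar.rank = k →
            (∀ i < k, (Matrix.toEuclideanLin Mstar).singularValues i ∈ Set.Icc smin smax) →
            0 < δ → δ < 1 → EMF.RIP (2 * k) δ A →
            δ ≤ C₃ / k * ((min ω (1 - ω)) ^ 2 / (max ω (1 - ω)) ^ 2) →
            ∀ ε : ℝ, 0 < ε →
            ∀ T : ℕ, 1 ≤ T →
              c ω * (Real.log (C₄ / ε) + Real.log (min ω (1 - ω) / max ω (1 - ω))) ≤ (T : ℝ) →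
              ∀ (Xbar Xhalf : ℕ → Matrix (Fin m) (Fin k) ℝ)
                (Ybar Yhalf : ℕ → Matrix (Fin n) (Fin k) ℝ),
                EMF.IsRun ω A (EMF.measure A Mstar) T Xbar Xhalf Ybar Yhalf →
                ‖Xhalf (T - 1) * (Ybar T)ᵀ - Mstar‖ ≤ ε := by
  -- The rate needs only `24 / r`; the absolute value and the `1` keep `c` positive for `ω` outside
  -- `(0, 1)` too.
  refine ⟨fun ω => 1 + |24 * (max ω (1 - ω) / min ω (1 - ω))|, fun ω => by positivity, ?_⟩
  intro smin smax hsmin hle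
  have hsmax : 0 < smax := hsmin.trans_le hle
  refine ⟨smin / (24 * smax), by positivity, smin, hsmin, ?_⟩
  intro ω h0 h1 m n p k hk1 A M δ hk hM hδ0 _ hA hδ ε hε T hT hiter Xbar Xhalf Ybar Yhalf hrun
  have ha : 0 < min ω (1 - ω) := lt_min h0 (by linarith)
  have hb : 0 < max ω (1 - ω) := lt_max_of_lt_left h0
  rw [← div_pow] at hδ
  have hcr : max ω (1 - ω) / min ω (1 - ω) = (min ω (1 - ω) / max ω (1 - ω))⁻¹ := by
    rw [inv_div]
  have hr1 : min ω (1 - ω) / max ω (1 - ω) ≤ 1 := by rw [div_le_one hb]; exact min_le_max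
  have hr0 : 0 < min ω (1 - ω) / max ω (1 - ω) := by positivity
  beta_reduce at hiter
  rw [hcr, abs_of_nonneg (by positivity)] at hiter
  obtain ⟨r, hr⟩ : ∃ r, r = min ω (1 - ω) / max ω (1 - ω) := ⟨_, rfl⟩
  rw [← hr] at hδ hr1 hr0 hiter
  have hk1' : (1 : ℝ) ≤ k := by exact_mod_cast hk1
  have hδk : δ * k ≤ smin / (24 * smax) * r ^ 2 := by
    rw [div_mul_eq_mul_div, le_div_iff₀ (by positivity)] at hδ
    exact hδ
  have hC : smin / (24 * smax) ≤ 1 / 24 := by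
    rw [div_le_div_iff₀ (by positivity) (by norm_num)]
    linarith
  have hr2 : r ^ 2 ≤ 1 := pow_le_one₀ hr0.le hr1
  have hδhalf : δ ≤ 1 / 2 := by
    have h2 : smin / (24 * smax) * r ^ 2 ≤ 1 / 24 * 1 := by gcongr
    nlinarith
  -- Here `576 = 24 ^ 2` comes from `C₃`. The basin condition needs only `r ^ 2` on the right; the
  -- surplus powers of `r` produce the `log r` in the iteration bound.
  have hδM : 576 * (δ ^ 2 * ‖M‖ ^ 2) ≤ smin ^ 2 * r ^ 4 := by
    have h2 := EMF.norm_sq_le_of_singularValues_le hk fun i hi => (hM i hi).2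
    have h3 : δ ^ 2 * ‖M‖ ^ 2 ≤ (δ * k) ^ 2 * smax ^ 2 := by
      calc δ ^ 2 * ‖M‖ ^ 2 ≤ δ ^ 2 * (k * smax ^ 2) := by gcongr
        _ = δ ^ 2 * k * 1 * smax ^ 2 := by ring
        _ ≤ δ ^ 2 * k * k * smax ^ 2 := by gcongr
        _ = _ := by ring
    calc 576 * (δ ^ 2 * ‖M‖ ^ 2) ≤ 576 * ((smin / (24 * smax) * r ^ 2) ^ 2 * smax ^ 2) := by
          refine mul_le_mul_of_nonneg_left (h3.trans ?_) (by norm_num)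
          gcongr
      _ = smin ^ 2 * r ^ 4 := by field_simp; ring
  have hr4 : r ^ 4 ≤ r ^ 3 := pow_le_pow_of_le_one hr0.le hr1 (by norm_num)
  have hr3 : r ^ 3 ≤ r ^ 2 := pow_le_pow_of_le_one hr0.le hr1 (by norm_num)
  have hconv := hrun.norm_sq_residual_le h0 h1 hδ0 hδhalf hA hk hsmin (fun i hi => (hM i hi).1) hr
    (by nlinarith [sq_nonneg smin, mul_nonneg (sq_nonneg δ) (sq_nonneg ‖M‖)])
    (show T - 1 < T by omega)
  rw [Nat.sub_add_cancel hT] at hconv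
  -- If the logarithm is negative, the bound holds for every `T`.
  have hlog : Real.log (smin * r / ε) ≤ r / 24 * T := by
    rw [mul_div_right_comm, Real.log_mul (by positivity) (by positivity)]
    set l := Real.log (smin / ε) + Real.log r
    by_cases hl : 0 ≤ l
    · have h2 : 24 * r⁻¹ * l ≤ T := by linarith
      calc l = r / 24 * (24 * r⁻¹ * l) := by field_simp
        _ ≤ r / 24 * T := by gcongr
    · exact (le_of_not_ge hl).trans (by positivity)
  have hexp : smin * r ≤ ε * Real.exp (r / 24 * T) := by
    rw [Real.log_le_iff_le_exp (by positivity), div_le_iff₀ hε] at hlog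
    linarith
  -- The loss contracts at rate `r / 12`, hence the norm at rate `r / 24`.
  have hq : (1 - r / 12) ^ T * Real.exp (r / 24 * T) ^ 2 ≤ 1 := by
    have h2 : 1 - r / 12 ≤ Real.exp (-(r / 12)) := by linarith [Real.add_one_le_exp (-(r / 12))]
    calc (1 - r / 12) ^ T * Real.exp (r / 24 * T) ^ 2
        ≤ Real.exp (-(r / 12)) ^ T * Real.exp (r / 24 * T) ^ 2 := by
          gcongr
          linarith
      _ = 1 := by
          rw [← Real.exp_nat_mul, ← Real.exp_nat_mul, ← Real.exp_add, Real.exp_eq_one_iff]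
          push_cast
          ring
  have hq0 : 0 ≤ (1 - r / 12) ^ T := pow_nonneg (by linarith) _
  rw [norm_sub_rev, ← sq_le_sq₀ (norm_nonneg _) hε.le]
  refine le_of_mul_le_mul_left ?_ hr0
  calc r * ‖M - Xhalf (T - 1) * (Ybar T)ᵀ‖ ^ 2
      ≤ (1 - r / 12) ^ T * (12 * δ ^ 2 * ‖M‖ ^ 2) := hconv
    _ ≤ (1 - r / 12) ^ T * (r * (smin * r) ^ 2) := by
        refine mul_le_mul_of_nonneg_left ?_ hq0
        have : smin ^ 2 * r ^ 4 ≤ smin ^ 2 * r ^ 3 := by gcongr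
        nlinarith [mul_nonneg (sq_nonneg δ) (sq_nonneg ‖M‖)]
    _ ≤ (1 - r / 12) ^ T * (r * (ε * Real.exp (r / 24 * T)) ^ 2) := by gcongr
    _ = r * ε ^ 2 * ((1 - r / 12) ^ T * Real.exp (r / 24 * T) ^ 2) := by ring
    _ ≤ r * ε ^ 2 := mul_le_of_le_one_right (by positivity) hq
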